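/- All knots and curves are smooth. A shadow is a closed curve in the plane whose only self-intersections are finitely many transverse double points, called precrossings; a pseudodiagram is a shadow in which some of the precrossings have been resolved, that is, one of the two strands at each of them has been declared to be the over-strand. A pseudodiagram is unknotted (respectively knotted) if every way of resolving its remaining precrossings yields a diagram of the unknot (respectively of a nontrivial knot). In the game To Knot or Not to Knot on a shadow, two players, Ursula and King Lear, alternately resolve one precrossing each, in either way, until none is left. Ursula wins if the resulting knot is trivial, and King Lear wins if it is nontrivial. Let $S$ be a shadow which, up to planar isotopy, consists of a tangle $T_1$ in the half-plane $x\le 0$ and a tangle $T_2$ in the half-plane $x\ge 1$ that are joined by the two parallel arcs $[0,1]\times\{1\}$ and $[0,1]\times\{-1\}$. Let $S'$ be the shadow obtained, up to planar isotopy, from $S$ by flipping $T_2$, that is, by replacing $T_2$ by its reflection in the $x$-axis and the two parallel arcs by two arcs in the strip $0\le x\le 1$ that join the same points of $T_1$ to the corresponding points of the flipped $T_2$ and cross each other exactly once, transversally, in a new (nugatory) precrossing $c$. **Theorem 3.** If a certain player (Ursula or King Lear) has a winning strategy on $S$ when playing second, then the same player has a winning strategy on $S'$ when playing first. Moreover,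 for each of the two ways of resolving $c$, there is such a winning strategy whose first move is to resolve $c$ in that way. -/

import Mathlib

open scoped ContDiff

namespace KnotGame

/-! ### Knots in space -/

/-- A (tame) knot: a smooth embedding of the circle `ℝ / ℤ` in three-space.
Smoothness and derivatives are those of the lift to a 1-periodic map on `ℝ`. -/
structure Knot where
  toFun : UnitAddCircle → ℝ × ℝ × ℝ
  smooth : ContDiff ℝ ∞ (fun t : ℝ => toFun (t : UnitAddCircle))
  immersed : ∀ t : ℝ, deriv (fun s : ℝ => toFun (s : UnitAddCircle)) t ≠ 0
  injective : Function.Injective toFun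

/-- Two knots are equivalent if one can be deformed into the other through a smooth family of knots
(a smooth isotopy of embeddings). -/
def Knot.Equivalent (K L : Knot) : Prop :=
  ∃ H : ℝ → Knot,
    ContDiff ℝ ∞ (fun x : ℝ × ℝ => (H x.1).toFun (x.2 : UnitAddCircle)) ∧
      H 0 = K ∧ H 1 = L

/-- The 1-periodic parametrization of the unit circle, on the line. -/
theorem unitCircle_lift (t : ℝ) :
    (((AddCircle.toCircle (t : UnitAddCircle) : ℂ).re,
      (AddCircle.toCircle (t : UnitAddCircle) : ℂ).im, (0 : ℝ)) : ℝ × ℝ × ℝ)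
      = (Real.cos (2 * Real.pi * t), Real.sin (2 * Real.pi * t), 0) := by
  rw [AddCircle.toCircle_apply_mk, Circle.coe_exp]
  have h : ((2 * Real.pi / 1 * t : ℝ) : ℂ) = ((2 * Real.pi * t : ℝ) : ℂ) := by simp
  rw [h, Complex.exp_ofReal_mul_I_re, Complex.exp_ofReal_mul_I_im]

/-- The unit circle `t ↦ (cos 2πt, sin 2πt, 0)` in the horizontal coordinate plane. -/
noncomputable def unitCircle : Knot where
  toFun u := ((AddCircle.toCircle u : ℂ).re, (AddCircle.toCircle u : ℂ).im, 0)
  smooth := by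
    simp only [unitCircle_lift]
    fun_prop
  immersed t := by
    simp only [unitCircle_lift]
    have hm : HasDerivAt (fun s : ℝ => 2 * Real.pi * s) (2 * Real.pi) t := by
      simpa using (hasDerivAt_id t).const_mul (2 * Real.pi)
    have h := hm.cos.prodMk (hm.sin.prodMk (hasDerivAt_const t (0 : ℝ)))
    rw [h.deriv]
    intro h0
    have h1 := congrArg (fun q : ℝ × ℝ × ℝ => q.1) h0
    have h2 := congrArg (fun q : ℝ × ℝ × ℝ => q.2.1) h0
    simp [Real.pi_ne_zero] at h1 h2
    have h3 := Real.sin_sq_add_cos_sq (2 * Real.pi * t)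
    rw [h1, h2] at h3
    norm_num at h3
  injective u v huv := by
    apply AddCircle.injective_toCircle (one_ne_zero : (1 : ℝ) ≠ 0)
    apply Circle.ext
    simp only [Prod.mk.injEq] at huv
    exact Complex.ext huv.1 huv.2.1

/-- A knot is trivial (an unknot) if it is equivalent to the unit circle in a plane. -/
def Knot.IsUnknot (K : Knot) : Prop := K.Equivalent unitCircle

/-! ### Shadows and pseudodiagrams -/

/-- A shadow: a smoothly immersed closed curve in the plane whose only self-intersections are
finitely many transverse double points. Every double point is a precrossing. -/
structure Shadow where
  toFun : UnitAddCircle → ℝ × ℝ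
  smooth : ContDiff ℝ ∞ (fun t : ℝ => toFun (t : UnitAddCircle))
  immersed : ∀ t : ℝ, deriv (fun s : ℝ => toFun (s : UnitAddCircle)) t ≠ 0
  double : ∀ u v w, toFun u = toFun v → toFun v = toFun w → u = v ∨ v = w ∨ u = w
  transverse : ∀ s t : ℝ, (s : UnitAddCircle) ≠ (t : UnitAddCircle) →
    toFun (s : UnitAddCircle) = toFun (t : UnitAddCircle) →
      LinearIndependent ℝ ![deriv (fun r : ℝ => toFun (r : UnitAddCircle)) s,
        deriv (fun r : ℝ => toFun (r : UnitAddCircle)) t]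
  finite_crossings : {u | ∃ v, v ≠ u ∧ toFun v = toFun u}.Finite

/-- `u` is the parameter of one of the two strands that meet at a double point of the curve. -/
def Shadow.IsCrossingStrand (S : Shadow) (u : UnitAddCircle) : Prop :=
  ∃ v, v ≠ u ∧ S.toFun v = S.toFun u

/-- A pseudodiagram with underlying shadow `S`. A crossing is resolved by declaring one of its two
strands to be the over-strand; `overStrands` is the set of parameters of the over-strands at the resolved
crossings. The other crossings are precrossings. -/
@[ext]
structure Pseudodiagram (S : Shadow) where
  overStrands : Set UnitAddCircle
  isCrossingStrand : ∀ u ∈ overStrands, S.IsCrossingStrand u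
  unique : ∀ u ∈ overStrands, ∀ v ∈ overStrands, S.toFun u = S.toFun v → u = v

namespace Pseudodiagram

variable {S : Shadow}

/-- The pseudodiagram without any resolved crossing, i.e. the shadow itself. -/
def ofShadow (S : Shadow) : Pseudodiagram S where
  overStrands := ∅
  isCrossingStrand := by simp
  unique := by simp

/-- `u` is one of the two strands at a precrossing of `P`. Making `u` the over-strand there is
then a legal move. -/
def IsLegal (P : Pseudodiagram S) (u : UnitAddCircle) : Prop :=
  S.IsCrossingStrand u ∧ ∀ v ∈ P.overStrands, S.toFun v ≠ S.toFun u

/-- Resolve the precrossing on the strand `u`, with `u` as the over-strand. -/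
def resolve (P : Pseudodiagram S) (u : UnitAddCircle) (h : P.IsLegal u) : Pseudodiagram S where
  overStrands := insert u P.overStrands
  isCrossingStrand := by
    rintro v (rfl | hv)
    · exact h.1
    · exact P.isCrossingStrand v hv
  unique := by
    rintro v (rfl | hv) w (rfl | hw) hvw
    · rfl
    · exact absurd hvw.symm (h.2 w hw)
    · exact absurd hvw (h.2 v hv)
    · exact P.unique v hv w hw hvw

/-- No precrossing is left: `P` is a knot diagram. -/
def IsComplete (P : Pseudodiagram S) : Prop := ∀ u, ¬ P.IsLegal u

/-- The knot `K` projects vertically to the shadow and, at every resolved crossing of `P`, the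
over-strand lies above the other strand. For complete `P`, this says that `P` is a diagram
of `K`. -/
def IsDiagramOf (P : Pseudodiagram S) (K : Knot) : Prop :=
  (∀ u, ((K.toFun u).1, (K.toFun u).2.1) = S.toFun u) ∧
    ∀ u ∈ P.overStrands, ∀ v, v ≠ u → S.toFun v = S.toFun u → (K.toFun v).2.2 < (K.toFun u).2.2

/-- The knot diagram `P` represents the unknot. -/
def RepresentsUnknot (P : Pseudodiagram S) : Prop := ∃ K : Knot, P.IsDiagramOf K ∧ K.IsUnknot

/-- A pseudodiagram is unknotted if all ways to resolve its precrossings yield the unknot. -/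
def Unknotted (P : Pseudodiagram S) : Prop :=
  ∀ Q : Pseudodiagram S, (P.overStrands : Set UnitAddCircle) ⊆ Q.overStrands →
    Q.IsComplete → Q.RepresentsUnknot

/-- A pseudodiagram is knotted if all ways to resolve its precrossings yield nontrivial knots. -/
def Knotted (P : Pseudodiagram S) : Prop :=
  ∀ Q : Pseudodiagram S, (P.overStrands : Set UnitAddCircle) ⊆ Q.overStrands →
    Q.IsComplete → ¬ Q.RepresentsUnknot

end Pseudodiagram

/-! ### The game "To Knot or Not to Knot" -/

/-- The two players. -/
inductive Player
  | ursula
  | kingLear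

/-- The opponent of a player. -/
def Player.opponent : Player → Player
  | .ursula => .kingLear
  | .kingLear => .ursula

/-- Ursula wants an unknotted, King Lear a knotted pseudodiagram. -/
def Player.Goal {S : Shadow} : Player → Pseudodiagram S → Prop
  | .ursula, P => P.Unknotted
  | .kingLear, P => P.Knotted

/-- A strategy on `S` prescribes, for every pseudodiagram that can occur, which strand is made the
over-strand at its precrossing. -/
abbrev Strategy (S : Shadow) : Type := Pseudodiagram S → UnitAddCircle

/-- `Reachable p σ first q P`: in the game on `S` in which `first` makes the first move and `p`
follows the strategy `σ`, the pseudodiagram `P` can occur with `q` to move. -/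
inductive Reachable {S : Shadow} (p : Player) (σ : Strategy S) (first : Player) :
    Player → Pseudodiagram S → Prop
  | start : Reachable p σ first first (Pseudodiagram.ofShadow S)
  | own {P : Pseudodiagram S} (hP : Reachable p σ first p P) (h : P.IsLegal (σ P)) :
      Reachable p σ first p.opponent (P.resolve (σ P) h)
  | reply {P : Pseudodiagram S} {u : UnitAddCircle}
      (hP : Reachable p σ first p.opponent P) (h : P.IsLegal u) :
      Reachable p σ first p (P.resolve u h)

/-- `σ` is a winning strategy for `p` in the game on `S` in which `first` moves first: it
prescribes a legal move whenever `p` has to move, and every play in which `p` follows it ends, when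
all crossings are resolved, with the goal of `p` achieved. (A pseudodiagram that is knotted or
unknotted stays so under further moves, so it does not matter whether play stops earlier.) -/
def Strategy.IsWinning {S : Shadow} (σ : Strategy S) (p first : Player) : Prop :=
  (∀ P : Pseudodiagram S, Reachable p σ first p P → ¬ P.IsComplete → P.IsLegal (σ P)) ∧
    ∀ (q : Player) (P : Pseudodiagram S), Reachable p σ first q P → P.IsComplete → p.Goal P

/-- Player `p` has a winning strategy on `S` when playing first. -/
def Shadow.WinsPlayingFirst (S : Shadow) (p : Player) : Prop :=
  ∃ σ : Strategy S, σ.IsWinning p p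

/-- Player `p` has a winning strategy on `S` when playing second. -/
def Shadow.WinsPlayingSecond (S : Shadow) (p : Player) : Prop :=
  ∃ σ : Strategy S, σ.IsWinning p p.opponent

/-! ### Flipping a tangle -/

/-- A smooth isotopy of the plane: a smooth family of diffeomorphisms that starts at the
identity. -/
def IsPlanarIsotopy (Φ : ℝ → ℝ × ℝ → ℝ × ℝ) : Prop :=
  ContDiff ℝ ∞ (fun x : ℝ × (ℝ × ℝ) => Φ x.1 x.2) ∧
    (∀ s ∈ Set.Icc (0 : ℝ) 1, ∃ Ψ : ℝ × ℝ → ℝ × ℝ, ContDiff ℝ ∞ Ψ ∧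
      Function.LeftInverse Ψ (Φ s) ∧ Function.RightInverse Ψ (Φ s)) ∧
    Φ 0 = id

/-- `f` carries the shadow `S` onto the shadow `S'`, up to a change of parameter of the circle,
possibly orientation-reversing, given by its lift `ρ` to the line. -/
def Carries (f : ℝ × ℝ → ℝ × ℝ) (S S' : Shadow) : Prop :=
  ∃ ρ : ℝ → ℝ, ContDiff ℝ ∞ ρ ∧ (∀ t, deriv ρ t ≠ 0) ∧
    ((∀ t, ρ (t + 1) = ρ t + 1) ∨ (∀ t, ρ (t + 1) = ρ t - 1)) ∧
    ∀ t : ℝ, S'.toFun (ρ t : UnitAddCircle) = f (S.toFun (t : UnitAddCircle))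

/-- The shadow consists of a tangle `T₁` in the half-plane `x ≤ 0` and a tangle `T₂` in the
half-plane `x ≥ 1`, joined by the two parallel arcs `[0,1] × {1}` and `[0,1] × {-1}`. -/
def Shadow.IsTwoTangles (S : Shadow) : Prop :=
  ∀ q : ℝ × ℝ, q.1 ∈ Set.Icc (0 : ℝ) 1 → (q ∈ Set.range S.toFun ↔ q.2 = 1 ∨ q.2 = -1)

/-- The planar picture of turning the half-plane `x ≥ 1` by a half turn about the `x`-axis while
keeping the half-plane `x ≤ 0` fixed: the identity for `x ≤ 0`, the reflection `(x, y) ↦ (x, -y)`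
for `x ≥ 1`, and in between the arcs `y = 1` and `y = -1` become arcs that cross once, at
`(1/2, 0)`. -/
noncomputable def flipMap (q : ℝ × ℝ) : ℝ × ℝ :=
  (q.1, Real.cos (Real.pi * Real.smoothTransition q.1) * q.2)

/-- `S'` is obtained from `S` by flipping the tangle `T₂`, which introduces the new (nugatory)
precrossing `c`. Both shadows are considered up to planar isotopy, `c` being carried along. -/
def IsFlip (S S' : Shadow) (c : ℝ × ℝ) : Prop :=
  ∃ (N N' : Shadow) (Φ Φ' : ℝ → ℝ × ℝ → ℝ × ℝ),
    N.IsTwoTangles ∧ (∀ u, N'.toFun u = flipMap (N.toFun u)) ∧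
    IsPlanarIsotopy Φ ∧ Carries (Φ 1) N S ∧
    IsPlanarIsotopy Φ' ∧ Carries (Φ' 1) N' S' ∧
    c = Φ' 1 (1 / 2, 0)

end KnotGame

namespace KnotGame

/-! ### Equivalence of knots -/

/-! The crossing `c` is nugatory. Lift a diagram over the two-tangle shadow to a knot in space and
turn the half-space `x ≥ 1` by a half turn about the `x`-axis, twisting the strip in between. This
is an ambient isotopy, the new projection is the flipped shadow, and the sense of the turn decides
which strand is over at `c`. So once `c` has been resolved, in either way, the remaining game on
`S'` is a copy of the game on `S`: the player spends the first move on `c` and from then on plays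
the second player's strategy. A half turn reverses heights, so the dictionary between moves
exchanges the two strands at the crossings of `T₂` (`flipStrand`) and keeps those of `T₁`.

On the geometric side, `exists_knot` lifts a diagram with height zero along the two arcs, so that
the twist in `exists_knot_twist` projects exactly to `flipMap`. `exists_knot_carried` passes to `S`
and `S'` through planar isotopies and changes of parameter, neither of which affects triviality.
Since a complete diagram determines its knot (`Pseudodiagram.IsComplete.equivalent`), one lift on
each side suffices to compare outcomes; this is `representsUnknot_iff`. The game side is formal: a
`StrandMap` translates positions, `reachable` is the invariant of play, and `strategy_isWinning`
concludes. -/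

theorem Knot.ext_toFun {K L : Knot} (h : ∀ u, K.toFun u = L.toFun u) : K = L := by
  cases K; cases L
  obtain rfl := funext h
  rfl

theorem Knot.hasDerivAt (K : Knot) (t : ℝ) :
    HasDerivAt (fun s : ℝ => K.toFun (s : UnitAddCircle))
      (deriv (fun s : ℝ => K.toFun (s : UnitAddCircle)) t) t :=
  (K.smooth.differentiable (by simp) t).hasDerivAt

theorem Shadow.hasDerivAt (S : Shadow) (t : ℝ) :
    HasDerivAt (fun s : ℝ => S.toFun (s : UnitAddCircle))
      (deriv (fun s : ℝ => S.toFun (s : UnitAddCircle)) t) t :=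
  (S.smooth.differentiable (by simp) t).hasDerivAt

theorem Knot.Equivalent.symm {K L : Knot} (h : K.Equivalent L) : L.Equivalent K := by
  obtain ⟨H, hH, h0, h1⟩ := h
  refine ⟨fun s => H (1 - s), ?_, by simpa using h1, by simpa using h0⟩
  have : ContDiff ℝ ∞ (fun x : ℝ × ℝ => (1 - x.1, x.2)) := by fun_prop
  exact hH.comp this

theorem Knot.Equivalent.trans {K L M : Knot} (h : K.Equivalent L) (h' : L.Equivalent M) :
    K.Equivalent M := by
  obtain ⟨H, hH, h0, h1⟩ := h
  obtain ⟨G, hG, g0, g1⟩ := h'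
  -- Both retimed families rest at `L` for `s` between `1/3` and `2/3`, so switching from one to the
  -- other at `1/2` is smooth.
  have e1 : ∀ s : ℝ, 1 / 3 ≤ s → H (Real.smoothTransition (3 * s)) = L := fun s hs => by
    rw [Real.smoothTransition.one_of_one_le (by linarith), h1]
  have e2 : ∀ s : ℝ, s ≤ 2 / 3 → G (Real.smoothTransition (3 * s - 2)) = L := fun s hs => by
    rw [Real.smoothTransition.zero_of_nonpos (by linarith), g0]
  have st : ContDiff ℝ ∞ Real.smoothTransition := Real.smoothTransition.contDiff
  refine ⟨fun s => if s ≤ 1 / 2 then H (Real.smoothTransition (3 * s))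
    else G (Real.smoothTransition (3 * s - 2)), ?_, ?_, ?_⟩
  · have c1 : ContDiff ℝ ∞ (fun x : ℝ × ℝ =>
        (H (Real.smoothTransition (3 * x.1))).toFun (x.2 : UnitAddCircle)) :=
      hH.comp ((st.comp (contDiff_const.mul contDiff_fst)).prodMk contDiff_snd)
    have c2 : ContDiff ℝ ∞ (fun x : ℝ × ℝ =>
        (G (Real.smoothTransition (3 * x.1 - 2))).toFun (x.2 : UnitAddCircle)) :=
      hG.comp ((st.comp ((contDiff_const.mul contDiff_fst).sub contDiff_const)).prodMk
        contDiff_snd)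
    rw [contDiff_iff_contDiffAt]
    intro x
    rcases lt_or_ge x.1 (1 / 2) with hx | hx
    · refine c1.contDiffAt.congr_of_eventuallyEq ?_
      filter_upwards [(isOpen_lt continuous_fst continuous_const).mem_nhds hx] with y hy
      have hy : y.1 < 1 / 2 := hy
      simp only [if_pos hy.le]
    · refine c2.contDiffAt.congr_of_eventuallyEq ?_
      have hx' : (1 / 3 : ℝ) < x.1 := by linarith
      filter_upwards [(isOpen_lt continuous_const continuous_fst).mem_nhds hx'] with y hy
      have hy : 1 / 3 < y.1 := hy
      split_ifs with h
      · rw [e1 _ hy.le, e2 _ (by linarith)]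
      · rfl
  · simp [h0]
  · norm_num [g1]

/-- The image of a knot under a smooth map with a smooth left inverse. -/
def Knot.map (K : Knot) (f : ℝ × ℝ × ℝ → ℝ × ℝ × ℝ) (hf : ContDiff ℝ ∞ f)
    (hinv : ∃ g, ContDiff ℝ ∞ g ∧ Function.LeftInverse g f) : Knot where
  toFun u := f (K.toFun u)
  smooth := hf.comp K.smooth
  immersed t h0 := by
    obtain ⟨g, hg, hgf⟩ := hinv
    apply K.immersed t
    have hd : HasDerivAt (fun s : ℝ => f (K.toFun (s : UnitAddCircle))) 0 t := by
      rw [← h0]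
      exact ((hf.comp K.smooth).differentiable (by simp) t).hasDerivAt
    have h2 := ((hg.differentiable (by simp)) (f (K.toFun (t : UnitAddCircle)))).hasFDerivAt
      |>.comp_hasDerivAt t hd
    have e : (g ∘ fun s : ℝ => f (K.toFun (s : UnitAddCircle)))
        = fun s : ℝ => K.toFun (s : UnitAddCircle) := funext fun s => hgf _
    rw [e, map_zero] at h2
    exact h2.deriv
  injective u v h := by
    obtain ⟨g, -, hgf⟩ := hinv
    exact K.injective (hgf.injective h)

/-- An ambient isotopy deforms a knot into an equivalent one. -/
theorem Knot.equivalent_map (K : Knot) (F : ℝ → ℝ × ℝ × ℝ → ℝ × ℝ × ℝ)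
    (hF : ContDiff ℝ ∞ (fun x : ℝ × (ℝ × ℝ × ℝ) => F x.1 x.2)) (h0 : F 0 = id)
    (hinv : ∀ s ∈ Set.Icc (0 : ℝ) 1, ∃ g, ContDiff ℝ ∞ g ∧ Function.LeftInverse g (F s))
    (hf : ContDiff ℝ ∞ (F 1)) (hfi : ∃ g, ContDiff ℝ ∞ g ∧ Function.LeftInverse g (F 1)) :
    K.Equivalent (K.map (F 1) hf hfi) := by
  have st : ContDiff ℝ ∞ Real.smoothTransition := Real.smoothTransition.contDiff
  -- Equivalences are indexed by the whole line, but `F s` is invertible only for `s` in `[0, 1]`;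
  -- `smoothTransition` maps the line smoothly into that interval and fixes its endpoints.
  refine ⟨fun s => K.map (F (Real.smoothTransition s))
    (hF.comp (contDiff_const.prodMk contDiff_id))
    (hinv _ ⟨Real.smoothTransition.nonneg s, Real.smoothTransition.le_one s⟩), ?_, ?_, ?_⟩
  · exact hF.comp ((st.comp contDiff_fst).prodMk (K.smooth.comp contDiff_snd))
  · exact Knot.ext_toFun fun u => by simp [Knot.map, h0]
  · exact Knot.ext_toFun fun u => by simp [Knot.map]

/-! ### Changes of parameter of the circle -/

/-- `ρ` is the lift to the line of a diffeomorphism of the circle. -/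
structure IsCircleLift (ρ : ℝ → ℝ) : Prop where
  smooth : ContDiff ℝ ∞ ρ
  deriv_ne : ∀ t, deriv ρ t ≠ 0
  add_one : (∀ t, ρ (t + 1) = ρ t + 1) ∨ (∀ t, ρ (t + 1) = ρ t - 1)

namespace IsCircleLift

variable {ρ : ℝ → ℝ}

/-- `ε` is the degree of the circle map; `ρ t - ε * t` is 1-periodic. -/
theorem exists_add_int (h : IsCircleLift ρ) :
    ∃ ε : ℤ, ε * ε = 1 ∧ ∀ (t : ℝ) (n : ℤ), ρ (t + n) = ρ t + ε * n := by
  have key : ∀ ε : ℤ, (∀ t, ρ (t + 1) = ρ t + ε) →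
      ∀ (t : ℝ) (n : ℤ), ρ (t + n) = ρ t + ε * n := by
    intro ε hε t n
    have hp : Function.Periodic (fun t => ρ t - ε * t) 1 := fun t => by
      simp only [hε]; ring
    have := hp.int_mul n t
    simp only [mul_one] at this
    linarith
  rcases h.add_one with h1 | h1
  · exact ⟨1, by norm_num, key 1 (by simpa using h1)⟩
  · exact ⟨-1, by norm_num, key (-1) (by simpa [sub_eq_add_neg] using h1)⟩

theorem hasDerivAt (h : IsCircleLift ρ) (t : ℝ) : HasDerivAt ρ (deriv ρ t) t :=
  (h.smooth.differentiable (by simp) t).hasDerivAt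

theorem injective (h : IsCircleLift ρ) : Function.Injective ρ := by
  intro s t hst
  by_contra hne
  wlog hlt : s < t generalizing s t
  · exact this hst.symm (Ne.symm hne) (lt_of_le_of_ne (not_lt.1 hlt) (Ne.symm hne))
  obtain ⟨c, -, hc⟩ := exists_deriv_eq_zero hlt h.smooth.continuous.continuousOn hst
  exact h.deriv_ne c hc

theorem surjective (h : IsCircleLift ρ) : Function.Surjective ρ := by
  obtain ⟨ε, hε, hn⟩ := h.exists_add_int
  have hε' : (ε : ℝ) * ε = 1 := by exact_mod_cast hε
  intro y
  have hv : ∀ m : ℤ, ρ (0 + (ε * m : ℤ)) = ρ 0 + m := fun m => by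
    rw [hn]; push_cast; rw [← mul_assoc, hε', one_mul]
  refine mem_range_of_exists_le_of_exists_ge h.smooth.continuous
    ⟨0 + (ε * ⌊y - ρ 0⌋ : ℤ), ?_⟩ ⟨0 + (ε * ⌈y - ρ 0⌉ : ℤ), ?_⟩
  · rw [hv]; linarith [Int.floor_le (y - ρ 0)]
  · rw [hv]; linarith [Int.le_ceil (y - ρ 0)]

theorem exists_inverse (h : IsCircleLift ρ) :
    ∃ τ, IsCircleLift τ ∧ (∀ t, ρ (τ t) = t) ∧ ∀ t, τ (ρ t) = t := by
  let e : ℝ ≃ₜ ℝ := (Equiv.ofBijective ρ ⟨h.injective, h.surjective⟩).toHomeomorphOfContinuousOpen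
    h.smooth.continuous (isOpenMap_of_hasStrictDerivAt
      (fun x => h.smooth.contDiffAt.hasStrictDerivAt (by simp)) h.deriv_ne)
  have hs : ContDiff ℝ ∞ e.symm := e.contDiff_symm_deriv h.deriv_ne h.hasDerivAt h.smooth
  have h1 : ∀ t, ρ (e.symm t) = t := e.apply_symm_apply
  have h2 : ∀ t, e.symm (ρ t) = t := e.symm_apply_apply
  refine ⟨e.symm, ⟨hs, fun t h0 => ?_, ?_⟩, h1, h2⟩
  · have hd : HasDerivAt e.symm 0 t := by
      rw [← h0]; exact (hs.differentiable (by simp) t).hasDerivAt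
    have hc := (h.hasDerivAt (e.symm t)).comp t hd
    have : (ρ ∘ e.symm) = id := funext h1
    rw [this, mul_zero] at hc
    exact zero_ne_one (hc.unique (hasDerivAt_id t))
  · rcases h.add_one with ha | ha
    · left
      intro t
      apply h.injective
      rw [h1, ha, h1]
    · right
      intro t
      apply h.injective
      have := ha (e.symm t - 1)
      rw [sub_add_cancel, h1] at this
      rw [h1]; linarith

/-- The map of the circle with lift `ρ`. -/
noncomputable def circleMap (h : IsCircleLift ρ) : UnitAddCircle → UnitAddCircle :=
  Function.Periodic.lift (f := fun t => (ρ t : UnitAddCircle)) (c := 1) fun t => by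
    obtain h | h := h.add_one
    · simp only [h, AddCircle.coe_add, AddCircle.coe_period, add_zero]
    · simp only [h, AddCircle.coe_sub, AddCircle.coe_period, sub_zero]

@[simp] theorem circleMap_coe (h : IsCircleLift ρ) (t : ℝ) :
    h.circleMap (t : UnitAddCircle) = (ρ t : UnitAddCircle) := rfl

theorem circleMap_leftInverse {τ : ℝ → ℝ} (h : IsCircleLift ρ) (h' : IsCircleLift τ)
    (e : ∀ t, τ (ρ t) = t) : Function.LeftInverse h'.circleMap h.circleMap := by
  intro u
  induction u using QuotientAddGroup.induction_on with
  | H t => exact congrArg _ (e t)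

/-- The diffeomorphism of the circle with lift `ρ`. -/
noncomputable def circleEquiv (h : IsCircleLift ρ) : UnitAddCircle ≃ UnitAddCircle where
  toFun := h.circleMap
  invFun := h.exists_inverse.choose_spec.1.circleMap
  left_inv := circleMap_leftInverse _ _ h.exists_inverse.choose_spec.2.2
  right_inv := circleMap_leftInverse _ _ h.exists_inverse.choose_spec.2.1

end IsCircleLift

/-- A smooth change of parameter of the circle. -/
def IsReparametrization (r : UnitAddCircle ≃ UnitAddCircle) : Prop :=
  ∃ ρ : ℝ → ℝ, IsCircleLift ρ ∧ ∀ t : ℝ, r (t : UnitAddCircle) = (ρ t : UnitAddCircle)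

theorem IsCircleLift.isReparametrization {ρ : ℝ → ℝ} (h : IsCircleLift ρ) :
    IsReparametrization h.circleEquiv := ⟨ρ, h, fun _ => rfl⟩

theorem IsCircleLift.isReparametrization_symm {ρ : ℝ → ℝ} (h : IsCircleLift ρ) :
    IsReparametrization h.circleEquiv.symm :=
  ⟨_, h.exists_inverse.choose_spec.1, fun _ => rfl⟩

theorem Carries.exists_equiv {f : ℝ × ℝ → ℝ × ℝ} {S S' : Shadow} (h : Carries f S S') :
    ∃ r : UnitAddCircle ≃ UnitAddCircle, IsReparametrization r.symm ∧
      ∀ u, S'.toFun (r u) = f (S.toFun u) := by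
  obtain ⟨ρ, h1, h2, h3, h4⟩ := h
  have hρ : IsCircleLift ρ := ⟨h1, h2, h3⟩
  refine ⟨hρ.circleEquiv, hρ.isReparametrization_symm, fun u => ?_⟩
  induction u using QuotientAddGroup.induction_on with
  | H t => exact h4 t

/-- A knot with another parametrization. -/
def Knot.reparametrize (K : Knot) (r : UnitAddCircle ≃ UnitAddCircle)
    (hr : IsReparametrization r) : Knot where
  toFun u := K.toFun (r u)
  smooth := by
    obtain ⟨ρ, hρ, h⟩ := hr
    simp only [h]
    exact K.smooth.comp hρ.smooth
  immersed t := by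
    obtain ⟨ρ, hρ, h⟩ := hr
    simp only [h]
    have := (K.hasDerivAt (ρ t)).scomp t (hρ.hasDerivAt t)
    rw [show (fun s : ℝ => K.toFun (ρ s : UnitAddCircle))
      = (fun s : ℝ => K.toFun (s : UnitAddCircle)) ∘ ρ from rfl, this.deriv]
    exact smul_ne_zero (hρ.deriv_ne t) (K.immersed _)
  injective := K.injective.comp r.injective

/-- The derivative has mean 1 over a period, so it equals 1 somewhere; being continuous and never
zero, it cannot change sign. -/
theorem IsCircleLift.deriv_pos {ρ : ℝ → ℝ} (h : IsCircleLift ρ) (h1 : ∀ t, ρ (t + 1) = ρ t + 1)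
    (t : ℝ) : 0 < deriv ρ t := by
  obtain ⟨c, -, hc⟩ := exists_deriv_eq_slope ρ (zero_lt_one' ℝ) h.smooth.continuous.continuousOn
    (h.smooth.differentiable (by simp)).differentiableOn
  have h01 := h1 0
  rw [zero_add] at h01
  rw [h01] at hc
  have hc : deriv ρ c = 1 := by rw [hc]; ring
  by_contra hneg
  obtain ⟨x, hx⟩ := mem_range_of_exists_le_of_exists_ge (h.smooth.continuous_deriv (by simp))
    ⟨t, not_lt.1 hneg⟩ ⟨c, by rw [hc]; norm_num⟩
  exact h.deriv_ne x hx

/-- Convex combinations of the identity and `ρ` are again increasing lifts of degree 1, so the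
straight line from the identity to `ρ` is an isotopy of parametrizations. This needs `ρ` to preserve
orientation. -/
theorem Knot.equivalent_reparametrize (K : Knot) (r : UnitAddCircle ≃ UnitAddCircle)
    (hr : IsReparametrization r) {ρ : ℝ → ℝ} (hρ : IsCircleLift ρ)
    (hrρ : ∀ t : ℝ, r (t : UnitAddCircle) = (ρ t : UnitAddCircle))
    (h1 : ∀ t, ρ (t + 1) = ρ t + 1) : K.Equivalent (K.reparametrize r hr) := by
  have st : ContDiff ℝ ∞ Real.smoothTransition := Real.smoothTransition.contDiff
  have hlift : ∀ s : ℝ, IsCircleLift fun t =>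
      (1 - Real.smoothTransition s) * t + Real.smoothTransition s * ρ t := by
    intro s
    have ha := Real.smoothTransition.nonneg s
    have hb := Real.smoothTransition.le_one s
    set a := Real.smoothTransition s
    refine ⟨(contDiff_const.mul contDiff_id).add (contDiff_const.mul hρ.smooth), fun t => ?_,
      Or.inl fun t => ?_⟩
    · have := ((hasDerivAt_id t).const_mul (1 - a)).add ((hρ.hasDerivAt t).const_mul a)
      have e : deriv (fun t => (1 - a) * t + a * ρ t) t = _ := this.deriv
      rw [e]
      have hp := hρ.deriv_pos h1 t
      rcases eq_or_lt_of_le hb with h | h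
      · rw [h]; simp [hp.ne']
      · have : 0 ≤ a * deriv ρ t := by positivity
        simp only [mul_one]
        linarith
    · rw [h1]; ring
  refine ⟨fun s => K.reparametrize (hlift s).circleEquiv (hlift s).isReparametrization, ?_, ?_, ?_⟩
  · exact K.smooth.comp (((contDiff_const.sub (st.comp contDiff_fst)).mul contDiff_snd).add
      ((st.comp contDiff_fst).mul (hρ.smooth.comp contDiff_snd)))
  · refine Knot.ext_toFun fun u => ?_
    induction u using QuotientAddGroup.induction_on with
    | H t =>
      change K.toFun (((1 - Real.smoothTransition 0) * t + Real.smoothTransition 0 * ρ t : ℝ) :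
        UnitAddCircle) = K.toFun (t : UnitAddCircle)
      simp
  · refine Knot.ext_toFun fun u => ?_
    induction u using QuotientAddGroup.induction_on with
    | H t =>
      change K.toFun (((1 - Real.smoothTransition 1) * t + Real.smoothTransition 1 * ρ t : ℝ) :
        UnitAddCircle) = K.toFun (r (t : UnitAddCircle))
      simp [hrρ]

/-! ### Reversing the orientation of a knot -/

theorem isReparametrization_neg : IsReparametrization (Equiv.neg UnitAddCircle) := by
  refine ⟨fun t => -t, ⟨contDiff_neg, fun t => ?_, Or.inr fun t => by ring⟩, fun t => rfl⟩
  simp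

/-- The rotation of space about the first coordinate axis. -/
noncomputable def rotateX (θ : ℝ) (q : ℝ × ℝ × ℝ) : ℝ × ℝ × ℝ :=
  (q.1, Real.cos θ * q.2.1 - Real.sin θ * q.2.2, Real.sin θ * q.2.1 + Real.cos θ * q.2.2)

theorem rotateX_leftInverse (θ : ℝ) : Function.LeftInverse (rotateX (-θ)) (rotateX θ) := by
  rintro ⟨x, y, z⟩
  have := Real.sin_sq_add_cos_sq θ
  simp only [rotateX, Real.cos_neg, Real.sin_neg, Prod.mk.injEq, true_and]
  constructor
  · linear_combination y * this
  · linear_combination z * this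

theorem isUnknot_of_equivalent {K L : Knot} (h : K.Equivalent L) : K.IsUnknot ↔ L.IsUnknot :=
  ⟨fun hK => h.symm.trans hK, fun hL => h.trans hL⟩

/-- Rotating space by `π` about the first axis maps the horizontal unit circle to itself with
reversed parameter. -/
theorem unitCircle_reverse_isUnknot :
    (unitCircle.reparametrize (Equiv.neg _) isReparametrization_neg).IsUnknot := by
  have hsm : ContDiff ℝ ∞ (fun x : ℝ × (ℝ × ℝ × ℝ) => rotateX (Real.pi * x.1) x.2) := by
    unfold rotateX; fun_prop
  have hsm' : ∀ θ, ContDiff ℝ ∞ (rotateX θ) := fun θ => by unfold rotateX; fun_prop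
  have h := Knot.equivalent_map unitCircle (fun s => rotateX (Real.pi * s)) hsm
    (by funext q; simp [rotateX]) (fun s _ => ⟨_, hsm' _, rotateX_leftInverse _⟩) (hsm' _)
    ⟨_, hsm' _, rotateX_leftInverse _⟩
  have e : unitCircle.reparametrize (Equiv.neg _) isReparametrization_neg
      = unitCircle.map (rotateX (Real.pi * 1)) (hsm' _) ⟨_, hsm' _, rotateX_leftInverse _⟩ := by
    refine Knot.ext_toFun fun u => ?_
    simp [Knot.reparametrize, Knot.map, rotateX, unitCircle, AddCircle.toCircle_neg]
  rw [e]
  exact h.symm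

theorem Knot.IsUnknot.reverse {K : Knot} (h : K.IsUnknot) :
    (K.reparametrize (Equiv.neg _) isReparametrization_neg).IsUnknot := by
  obtain ⟨H, hH, h0, h1⟩ := h
  refine Knot.Equivalent.trans (L := unitCircle.reparametrize (Equiv.neg _) isReparametrization_neg)
    ⟨fun s => (H s).reparametrize (Equiv.neg _) isReparametrization_neg, ?_, ?_, ?_⟩
    unitCircle_reverse_isUnknot
  · have : ContDiff ℝ ∞ (fun x : ℝ × ℝ => (x.1, -x.2)) := by fun_prop
    exact hH.comp this
  · simp only [h0]
  · simp only [h1]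

theorem Knot.isUnknot_reverse_iff {K : Knot} :
    (K.reparametrize (Equiv.neg _) isReparametrization_neg).IsUnknot ↔ K.IsUnknot := by
  refine ⟨fun h => ?_, fun h => h.reverse⟩
  have := h.reverse
  have e : (K.reparametrize (Equiv.neg _) isReparametrization_neg).reparametrize (Equiv.neg _)
      isReparametrization_neg = K := Knot.ext_toFun fun u => by simp [Knot.reparametrize]
  rwa [e] at this

/-- Triviality of a knot does not depend on its parametrization. -/
theorem Knot.isUnknot_reparametrize_iff (K : Knot) (r : UnitAddCircle ≃ UnitAddCircle)
    (hr : IsReparametrization r) : (K.reparametrize r hr).IsUnknot ↔ K.IsUnknot := by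
  have ⟨ρ, hρ, h⟩ := hr
  rcases hρ.add_one with h1 | h1
  · exact (isUnknot_of_equivalent (K.equivalent_reparametrize r hr hρ h h1)).symm
  -- An orientation-reversing `r` becomes orientation-preserving after negation; it is applied to
  -- the reversed knot, and the two negations cancel.
  · have hτ : IsCircleLift fun t => -ρ t :=
      ⟨hρ.smooth.neg, fun t => by simpa using hρ.deriv_ne t, Or.inl fun t => by rw [h1]; ring⟩
    have hr' : ∀ t : ℝ, (r.trans (Equiv.neg _)) (t : UnitAddCircle) = ((-ρ t : ℝ) : UnitAddCircle) :=
      fun t => by simp [h]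
    have key := isUnknot_of_equivalent ((K.reparametrize (Equiv.neg _)
      isReparametrization_neg).equivalent_reparametrize (r.trans (Equiv.neg _)) ⟨_, hτ, hr'⟩ hτ hr'
      fun t => by rw [h1]; ring)
    rw [Knot.isUnknot_reverse_iff] at key
    rw [key]
    apply iff_of_eq
    congr 1
    exact Knot.ext_toFun fun u => by simp [Knot.reparametrize]

/-! ### Knots over a shadow -/

/-- A smooth function on the circle with prescribed values on a finite set that vanishes on a
closed set. -/
theorem exists_smooth_height {A F : Set UnitAddCircle} (hA : IsClosed A) (hF : F.Finite)
    (hd : Disjoint F A) (w : UnitAddCircle → ℝ) :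
    ∃ z : UnitAddCircle → ℝ, ContDiff ℝ ∞ (fun t : ℝ => z (t : UnitAddCircle)) ∧
      (∀ u ∈ A, z u = 0) ∧ ∀ u ∈ F, z u = w u := by
  let ι : UnitAddCircle → ℂ := fun u => (AddCircle.toCircle u : ℂ)
  have hιc : Continuous ι := continuous_subtype_val.comp AddCircle.continuous_toCircle
  have hιi : Function.Injective ι :=
    Subtype.val_injective.comp (AddCircle.injective_toCircle (one_ne_zero : (1 : ℝ) ≠ 0))
  have hιs : ContDiff ℝ ∞ (fun t : ℝ => ι (t : UnitAddCircle)) := by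
    have : (fun t : ℝ => ι (t : UnitAddCircle))
        = fun t : ℝ => Complex.exp (((2 * Real.pi * t : ℝ) : ℂ) * Complex.I) := by
      funext t
      simp only [ι, AddCircle.toCircle_apply_mk, Circle.coe_exp, div_one]
    rw [this]
    exact ((Complex.ofRealCLM.contDiff.comp (contDiff_const.mul contDiff_id)).mul
      contDiff_const).cexp
  have hcl : IsClosed (ι '' A) := (hA.isCompact.image hιc).isClosed
  -- `χ` vanishes exactly on the image of `A`. Multiplying it by a polynomial that interpolates `w /
  -- χ` on `F` gives the required values in both places.
  obtain ⟨χ, hsupp, hχ, -⟩ := hcl.isOpen_compl.exists_contDiff_support_eq (n := ⊤)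
  let p := Lagrange.interpolate hF.toFinset ι fun u => ((w u / χ (ι u) : ℝ) : ℂ)
  have hp : ContDiff ℝ ∞ fun x : ℂ => p.eval x := by
    have := (Polynomial.contDiff_aeval (𝕜 := ℂ) (R := ℂ) p ∞).restrict_scalars ℝ
    simpa using this
  refine ⟨fun u => χ (ι u) * (p.eval (ι u)).re, ?_, fun u hu => ?_, fun u hu => ?_⟩
  · exact (hχ.comp hιs).mul (Complex.reCLM.contDiff.comp (hp.comp hιs))
  · have : χ (ι u) = 0 := by
      by_contra h
      have h' : ι u ∈ χ.support := h
      rw [hsupp] at h'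
      exact h' ⟨u, hu, rfl⟩
    simp [this]
  · have hne : χ (ι u) ≠ 0 := by
      have h' : ι u ∈ χ.support := by
        rw [hsupp]
        rintro ⟨v, hv, hvu⟩
        rw [hιi hvu] at hv
        exact Set.disjoint_left.1 hd hu hv
      exact h'
    have := Lagrange.eval_interpolate_at_node (s := hF.toFinset) (v := ι)
      (fun u => ((w u / χ (ι u) : ℝ) : ℂ)) hιi.injOn (hF.mem_toFinset.2 hu)
    simp only [p, this, Complex.ofReal_re]
    field_simp

/-- The knot over a shadow with a given height function. -/
def Shadow.lift (S : Shadow) (z : UnitAddCircle → ℝ)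
    (hz : ContDiff ℝ ∞ (fun t : ℝ => z (t : UnitAddCircle)))
    (hne : ∀ u v, u ≠ v → S.toFun u = S.toFun v → z u ≠ z v) : Knot where
  toFun u := ((S.toFun u).1, (S.toFun u).2, z u)
  smooth := S.smooth.fst.prodMk (S.smooth.snd.prodMk hz)
  immersed t h0 := by
    apply S.immersed t
    have hd : HasDerivAt (fun s : ℝ => ((S.toFun (s : UnitAddCircle)).1,
        (S.toFun (s : UnitAddCircle)).2, z (s : UnitAddCircle))) (0 : ℝ × ℝ × ℝ) t := by
      rw [← h0]
      exact ((S.smooth.fst.prodMk (S.smooth.snd.prodMk hz)).differentiable (by simp) t).hasDerivAt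
    have h2 := ((ContinuousLinearMap.fst ℝ ℝ (ℝ × ℝ)).prod ((ContinuousLinearMap.fst ℝ ℝ ℝ).comp
      (ContinuousLinearMap.snd ℝ ℝ (ℝ × ℝ)))).hasFDerivAt.comp_hasDerivAt t hd
    rw [map_zero] at h2
    exact h2.deriv
  injective u v h := by
    simp only [Prod.mk.injEq] at h
    by_contra huv
    exact hne u v huv (Prod.ext h.1 h.2.1) h.2.2

theorem Pseudodiagram.IsComplete.exists_mem {S : Shadow} {P : Pseudodiagram S}
    (hP : P.IsComplete) {u : UnitAddCircle} (hu : S.IsCrossingStrand u) :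
    ∃ w ∈ P.overStrands, S.toFun w = S.toFun u := by
  have := hP u
  simp only [Pseudodiagram.IsLegal, not_and, not_forall, not_not] at this
  obtain ⟨w, hw, h⟩ := this hu
  exact ⟨w, hw, h⟩

/-- A knot diagram determines the knot up to equivalence. -/
theorem Pseudodiagram.IsComplete.equivalent {S : Shadow} {P : Pseudodiagram S}
    (hP : P.IsComplete) {K L : Knot} (hK : P.IsDiagramOf K) (hL : P.IsDiagramOf L) :
    K.Equivalent L := by
  have st : ContDiff ℝ ∞ Real.smoothTransition := Real.smoothTransition.contDiff
  have zK := K.smooth.snd.snd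
  have zL := L.smooth.snd.snd
  -- Both knots lie over the same curve and have the same height order at every crossing;
  -- interpolating the heights linearly keeps that order strict, so no two strands ever collide.
  have mix : ∀ a x x' y y' : ℝ, 0 ≤ a → a ≤ 1 → x < y → x' < y' →
      (1 - a) * x + a * x' < (1 - a) * y + a * y' := by
    intro a x x' y y' h0 h1 h h'
    rcases eq_or_lt_of_le h0 with ha | ha
    · subst ha; linarith
    · nlinarith
  refine ⟨fun s => S.lift (fun u => (1 - Real.smoothTransition s) * (K.toFun u).2.2
      + Real.smoothTransition s * (L.toFun u).2.2)
      ((contDiff_const.mul zK).add (contDiff_const.mul zL)) ?_, ?_, ?_, ?_⟩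
  · intro u v huv hS
    have h0 := Real.smoothTransition.nonneg s
    have h1 := Real.smoothTransition.le_one s
    obtain ⟨w, hw, hwu⟩ := hP.exists_mem (u := u) ⟨v, huv.symm, hS.symm⟩
    rcases S.double w u v hwu hS with rfl | h | rfl
    · exact (mix _ _ _ _ _ h0 h1 (hK.2 _ hw v huv.symm hS.symm)
        (hL.2 _ hw v huv.symm hS.symm)).ne'
    · exact absurd h huv
    · exact (mix _ _ _ _ _ h0 h1 (hK.2 _ hw u huv hS) (hL.2 _ hw u huv hS)).ne
  · refine ContDiff.prodMk (S.smooth.fst.comp contDiff_snd) (ContDiff.prodMk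
      (S.smooth.snd.comp contDiff_snd) (ContDiff.add (ContDiff.mul
        (contDiff_const.sub (st.comp contDiff_fst)) (zK.comp contDiff_snd))
        (ContDiff.mul (st.comp contDiff_fst) (zL.comp contDiff_snd))))
  · refine Knot.ext_toFun fun u => ?_
    simp [Shadow.lift, ← hK.1 u]
  · refine Knot.ext_toFun fun u => ?_
    simp [Shadow.lift, ← hL.1 u]

theorem Pseudodiagram.IsComplete.representsUnknot_iff {S : Shadow} {P : Pseudodiagram S}
    (hP : P.IsComplete) {K : Knot} (hK : P.IsDiagramOf K) : P.RepresentsUnknot ↔ K.IsUnknot :=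
  ⟨fun ⟨_, hL, hU⟩ => (hP.equivalent hK hL).trans hU, fun h => ⟨K, hK, h⟩⟩

/-- Carrying a knot along with its projection under a planar isotopy. -/
theorem exists_knot_carried {N S : Shadow} {Φ : ℝ → ℝ × ℝ → ℝ × ℝ} (hΦ : IsPlanarIsotopy Φ)
    {r : UnitAddCircle ≃ UnitAddCircle} (hr : IsReparametrization r.symm)
    (hS : ∀ u, S.toFun (r u) = Φ 1 (N.toFun u)) {K : Knot}
    (hK : ∀ u, ((K.toFun u).1, (K.toFun u).2.1) = N.toFun u) :
    ∃ L : Knot, (L.IsUnknot ↔ K.IsUnknot) ∧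
      (∀ u, ((L.toFun u).1, (L.toFun u).2.1) = S.toFun u) ∧
      ∀ u, (L.toFun (r u)).2.2 = (K.toFun u).2.2 := by
  obtain ⟨hsm, hinv, h0⟩ := hΦ
  -- The planar isotopy acts on horizontal coordinates and leaves the height alone.
  let F : ℝ → ℝ × ℝ × ℝ → ℝ × ℝ × ℝ := fun s q =>
    ((Φ s (q.1, q.2.1)).1, (Φ s (q.1, q.2.1)).2, q.2.2)
  have hΦ' : ContDiff ℝ ∞ (fun x : ℝ × (ℝ × ℝ × ℝ) => Φ x.1 (x.2.1, x.2.2.1)) :=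
    hsm.comp (g := fun x : ℝ × (ℝ × ℝ) => Φ x.1 x.2)
      (f := fun x : ℝ × (ℝ × ℝ × ℝ) => (x.1, (x.2.1, x.2.2.1))) (by fun_prop)
  have hF : ContDiff ℝ ∞ (fun x : ℝ × (ℝ × ℝ × ℝ) => F x.1 x.2) :=
    hΦ'.fst.prodMk (hΦ'.snd.prodMk (by fun_prop))
  have hF1 : ContDiff ℝ ∞ (F 1) := hF.comp (contDiff_const.prodMk contDiff_id)
  have hFi : ∀ s ∈ Set.Icc (0 : ℝ) 1, ∃ g, ContDiff ℝ ∞ g ∧ Function.LeftInverse g (F s) := by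
    intro s hs
    obtain ⟨Ψ, hΨ, hl, -⟩ := hinv s hs
    have hΨ' : ContDiff ℝ ∞ (fun q : ℝ × ℝ × ℝ => Ψ (q.1, q.2.1)) :=
      hΨ.comp (by fun_prop : ContDiff ℝ ∞ fun q : ℝ × ℝ × ℝ => (q.1, q.2.1))
    refine ⟨fun q => ((Ψ (q.1, q.2.1)).1, (Ψ (q.1, q.2.1)).2, q.2.2),
      hΨ'.fst.prodMk (hΨ'.snd.prodMk (by fun_prop)), fun q => ?_⟩
    simp only [F, Prod.mk.eta, hl (q.1, q.2.1)]
  have hF0 : F 0 = id := by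
    funext q
    simp [F, h0]
  have hFi1 := hFi 1 (by simp)
  refine ⟨(K.map (F 1) hF1 hFi1).reparametrize r.symm hr, ?_, fun u => ?_, fun u => ?_⟩
  · rw [Knot.isUnknot_reparametrize_iff]
    exact (isUnknot_of_equivalent (K.equivalent_map F hF hF0 hFi hF1 hFi1)).symm
  · have := hS (r.symm u)
    rw [Equiv.apply_symm_apply] at this
    rw [this, ← hK]
    rfl
  · simp [Knot.reparametrize, Knot.map, F]

/-! ### Shadows made of two tangles -/

namespace Shadow

variable {N N' : Shadow}

/-- The parameters of the two parallel arcs, including their endpoints. -/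
def stripStrands (N : Shadow) : Set UnitAddCircle := closure {u | (N.toFun u).1 ∈ Set.Ioo (0 : ℝ) 1}

theorem IsTwoTangles.snd_eq (h : N.IsTwoTangles) {u : UnitAddCircle}
    (hu : (N.toFun u).1 ∈ Set.Icc (0 : ℝ) 1) : (N.toFun u).2 = 1 ∨ (N.toFun u).2 = -1 :=
  (h _ hu).1 ⟨u, rfl⟩

/-- Over the open strip `y ^ 2 = 1`, so `2 * y * y' = 0` with `y ≠ 0`; continuity of the derivative
extends this to the closure. -/
theorem IsTwoTangles.deriv_snd_eq_zero (h : N.IsTwoTangles) {t : ℝ}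
    (ht : (t : UnitAddCircle) ∈ N.stripStrands) :
    (deriv (fun s : ℝ => N.toFun (s : UnitAddCircle)) t).2 = 0 := by
  have hcl : IsClosed {t : ℝ | (deriv (fun s : ℝ => N.toFun (s : UnitAddCircle)) t).2 = 0} :=
    isClosed_eq (continuous_snd.comp (N.smooth.continuous_deriv (by simp))) continuous_const
  have hmem : t ∈ closure {t : ℝ | (N.toFun (t : UnitAddCircle)).1 ∈ Set.Ioo (0 : ℝ) 1} := by
    have := (QuotientAddGroup.isOpenMap_coe (N := AddSubgroup.zmultiples (1 : ℝ)))
      |>.preimage_closure_eq_closure_preimage QuotientAddGroup.continuous_mk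
        {u : UnitAddCircle | (N.toFun u).1 ∈ Set.Ioo (0 : ℝ) 1}
    have ht' : t ∈ (QuotientAddGroup.mk : ℝ → UnitAddCircle) ⁻¹' N.stripStrands := ht
    rw [stripStrands, this] at ht'
    exact ht'
  refine closure_minimal (fun s hs => ?_) hcl hmem
  have hd : HasDerivAt (fun r : ℝ => (N.toFun (r : UnitAddCircle)).2)
      (deriv (fun s : ℝ => N.toFun (s : UnitAddCircle)) s).2 s :=
    (ContinuousLinearMap.snd ℝ ℝ ℝ).hasFDerivAt.comp_hasDerivAt s (N.hasDerivAt s)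
  have hsq := hd.pow 2
  have hev : (fun r : ℝ => (N.toFun (r : UnitAddCircle)).2 ^ 2) =ᶠ[nhds s] fun _ => 1 := by
    have ho : IsOpen {t : ℝ | (N.toFun (t : UnitAddCircle)).1 ∈ Set.Ioo (0 : ℝ) 1} :=
      isOpen_Ioo.preimage N.smooth.fst.continuous
    filter_upwards [ho.mem_nhds hs] with r hr
    rcases h.snd_eq (Set.Ioo_subset_Icc_self hr) with h | h <;> rw [h] <;> norm_num
  have h1 := hsq.unique ((hasDerivAt_const s (1 : ℝ)).congr_of_eventuallyEq hev)
  rcases h.snd_eq (Set.Ioo_subset_Icc_self hs) with h | h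
  · simpa [h] using h1
  · simpa [h] using h1

/-- No crossing lies on the two parallel arcs. -/
theorem IsTwoTangles.eq_of_mem_stripStrands (h : N.IsTwoTangles) {u v : UnitAddCircle}
    (hu : u ∈ N.stripStrands) (hv : v ∈ N.stripStrands) (huv : N.toFun u = N.toFun v) : u = v := by
  by_contra hne
  induction u using QuotientAddGroup.induction_on with
  | H s =>
    induction v using QuotientAddGroup.induction_on with
    | H t =>
      have hs := h.deriv_snd_eq_zero (t := s) hu
      have ht := h.deriv_snd_eq_zero (t := t) hv
      have hli := LinearIndependent.pair_iff.1 (N.transverse s t hne huv)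
      -- Both tangent vectors are horizontal, hence linearly dependent, against transversality.
      have := hli (deriv (fun s : ℝ => N.toFun (s : UnitAddCircle)) t).1
        (-(deriv (fun s : ℝ => N.toFun (s : UnitAddCircle)) s).1) (by
          ext
          · simp; ring
          · simp [hs, ht])
      exact N.immersed t (Prod.ext this.1 ht)

theorem IsTwoTangles.fst_notMem (h : N.IsTwoTangles) {u v : UnitAddCircle} (hne : u ≠ v)
    (huv : N.toFun u = N.toFun v) : (N.toFun u).1 ∉ Set.Ioo (0 : ℝ) 1 := fun hu =>
  hne (h.eq_of_mem_stripStrands (subset_closure hu)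
    (subset_closure (show (N.toFun v).1 ∈ Set.Ioo (0 : ℝ) 1 from huv ▸ hu)) huv)

/-- Given the over-strands of a diagram over a two-tangle shadow, there is a knot with this diagram
whose height vanishes on the two parallel arcs. -/
theorem IsTwoTangles.exists_knot (h : N.IsTwoTangles) (O : Set UnitAddCircle)
    (hO : ∀ u v, u ≠ v → N.toFun u = N.toFun v → (u ∈ O ↔ v ∉ O)) :
    ∃ K : Knot, (∀ u, ((K.toFun u).1, (K.toFun u).2.1) = N.toFun u) ∧
      (∀ u ∈ N.stripStrands, (K.toFun u).2.2 = 0) ∧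
      ∀ u ∈ O, ∀ v, v ≠ u → N.toFun v = N.toFun u → (K.toFun v).2.2 < (K.toFun u).2.2 := by
  classical
  obtain ⟨z, hz, hzA, hzF⟩ := exists_smooth_height (A := N.stripStrands)
    (F := {u | ∃ v, v ≠ u ∧ N.toFun v = N.toFun u} \ N.stripStrands) isClosed_closure
    (N.finite_crossings.subset Set.sdiff_subset) Set.disjoint_sdiff_left
    (fun u => if u ∈ O then 1 else -1)
  -- Heights are `1` on over-strands, `-1` on under-strands and `0` on the arcs. A crossing on the
  -- boundary of the strip may involve one endpoint of an arc, but never two, so the heights still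
  -- differ in the right direction.
  have key : ∀ u ∈ O, ∀ v, v ≠ u → N.toFun v = N.toFun u → z v < z u := by
    intro u hu v hne huv
    have hv : v ∉ O := (hO u v hne.symm huv.symm).1 hu
    by_cases hAu : u ∈ N.stripStrands
    · have hAv : v ∉ N.stripStrands := fun hAv => hne (h.eq_of_mem_stripStrands hAv hAu huv)
      rw [hzA u hAu, hzF v ⟨⟨u, hne.symm, huv.symm⟩, hAv⟩, if_neg hv]
      norm_num
    · rw [hzF u ⟨⟨v, hne, huv⟩, hAu⟩, if_pos hu]
      by_cases hAv : v ∈ N.stripStrands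
      · rw [hzA v hAv]; norm_num
      · rw [hzF v ⟨⟨u, hne.symm, huv.symm⟩, hAv⟩, if_neg hv]; norm_num
  refine ⟨N.lift z hz fun u v hne huv => ?_, fun u => rfl, hzA, key⟩
  by_cases hu : u ∈ O
  · exact (key u hu v hne.symm huv.symm).ne'
  · have hv : v ∈ O := by
      by_contra hv
      exact hu ((hO u v hne huv).2 hv)
    exact (key v hv u hne huv).ne

/-! ### Twisting a tangle -/

/-- The two exponentials in the definition agree only when `x = 1 - x`. This makes `1/2` the only
abscissa at which `flipMap` collapses a vertical line, so `c` is the only new crossing. -/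
theorem smoothTransition_eq_half {x : ℝ} (h : Real.smoothTransition x = 1 / 2) : x = 1 / 2 := by
  have h0 : 0 < x := by
    by_contra h0
    rw [Real.smoothTransition.zero_of_nonpos (not_lt.1 h0)] at h
    norm_num at h
  have h1 : x < 1 := by
    by_contra h1
    rw [Real.smoothTransition.one_of_one_le (not_lt.1 h1)] at h
    norm_num at h
  have hp := Real.smoothTransition.pos_denom x
  unfold Real.smoothTransition at h
  have he : expNegInvGlue x = expNegInvGlue (1 - x) := by
    field_simp at h
    linarith
  simp only [expNegInvGlue, not_le.2 h0, not_le.2 (sub_pos.2 h1), if_false, Real.exp_eq_exp,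
    neg_inj, inv_inj] at he
  linarith

theorem smoothTransition_half : Real.smoothTransition (1 / 2) = 1 / 2 := by
  have hp := Real.smoothTransition.pos_denom (1 / 2)
  unfold Real.smoothTransition
  norm_num at hp ⊢
  field_simp
  ring

/-- Two strands that meet after the flip met before, unless they meet at the new precrossing. -/
theorem eq_of_flipMap_eq {u v : UnitAddCircle}
    (huv : flipMap (N.toFun u) = flipMap (N.toFun v)) :
    N.toFun u = N.toFun v ∨ flipMap (N.toFun u) = (1 / 2, 0) := by
  have hx : (N.toFun u).1 = (N.toFun v).1 := (Prod.ext_iff.1 huv).1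
  have hy := congrArg Prod.snd huv
  simp only [flipMap, ← hx] at hy
  by_cases hc : Real.cos (Real.pi * Real.smoothTransition (N.toFun u).1) = 0
  · right
    have h0 := Real.smoothTransition.nonneg (N.toFun u).1
    have h1 := Real.smoothTransition.le_one (N.toFun u).1
    have hpi := Real.pi_pos
    have : Real.pi * Real.smoothTransition (N.toFun u).1 = Real.pi / 2 :=
      Real.injOn_cos ⟨by positivity, by nlinarith⟩ ⟨by positivity, by linarith⟩ (by simp [hc])
    have hst := smoothTransition_eq_half (x := (N.toFun u).1) (by
      have h2 : Real.pi * (Real.smoothTransition (N.toFun u).1 - 1 / 2) = 0 := by linarith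
      rcases mul_eq_zero.1 h2 with h2 | h2 <;> linarith)
    simp only [flipMap, hc, zero_mul]
    rw [hst]
  · left
    exact Prod.ext hx (mul_left_cancel₀ hc hy)

theorem flipMap_half (y : ℝ) : flipMap (1 / 2, y) = (1 / 2, 0) := by
  simp only [flipMap, smoothTransition_half]
  rw [show Real.pi * (1 / 2) = Real.pi / 2 by ring, Real.cos_pi_div_two, zero_mul]

/-- Turning the half-space `x ≥ 1` about the first axis by the angle `a`, while keeping the
half-space `x ≤ 0` fixed. -/
noncomputable def twist (a : ℝ) (q : ℝ × ℝ × ℝ) : ℝ × ℝ × ℝ :=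
  rotateX (a * Real.smoothTransition q.1) q

/-- A twist preserves the first coordinate, hence the angle, and so is inverted slice by slice. -/
theorem twist_leftInverse (a : ℝ) : Function.LeftInverse (twist (-a)) (twist a) := fun q => by
  have := rotateX_leftInverse (a * Real.smoothTransition q.1) q
  rwa [← neg_mul] at this

theorem contDiff_twist : ContDiff ℝ ∞ (fun x : ℝ × (ℝ × ℝ × ℝ) => twist x.1 x.2) := by
  have st : ContDiff ℝ ∞ Real.smoothTransition := Real.smoothTransition.contDiff
  unfold twist rotateX
  fun_prop

/-- The new second coordinate is `cos * y - sin * z`. Outside the strip the angle is `0` or `±π`, so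
the sine vanishes; inside, `z = 0`. Hence the projection is exactly `flipMap`. The sign `ε` is the
sense of the half turn and decides which arc passes over at the middle of the strip. -/
theorem exists_knot_twist (hN' : ∀ u, N'.toFun u = flipMap (N.toFun u))
    {K : Knot} (hK : ∀ u, ((K.toFun u).1, (K.toFun u).2.1) = N.toFun u)
    (hK0 : ∀ u ∈ N.stripStrands, (K.toFun u).2.2 = 0) {ε : ℝ} (hε : ε = 1 ∨ ε = -1) :
    ∃ L : Knot, (L.IsUnknot ↔ K.IsUnknot) ∧
      (∀ u, ((L.toFun u).1, (L.toFun u).2.1) = N'.toFun u) ∧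
      (∀ u, (N.toFun u).1 ≤ 0 → (L.toFun u).2.2 = (K.toFun u).2.2) ∧
      (∀ u, 1 ≤ (N.toFun u).1 → (L.toFun u).2.2 = -(K.toFun u).2.2) ∧
      ∀ u, (N.toFun u).1 = 1 / 2 → (L.toFun u).2.2 = ε * (N.toFun u).2 := by
  have hs : ∀ a, ContDiff ℝ ∞ (twist a) := fun a =>
    contDiff_twist.comp (contDiff_const.prodMk contDiff_id)
  have hF : ContDiff ℝ ∞ (fun x : ℝ × (ℝ × ℝ × ℝ) => twist (ε * Real.pi * x.1) x.2) :=
    contDiff_twist.comp ((contDiff_const.mul contDiff_fst).prodMk contDiff_snd)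
  have hx : ∀ u, (K.toFun u).1 = (N.toFun u).1 := fun u => congrArg Prod.fst (hK u)
  have hy : ∀ u, (K.toFun u).2.1 = (N.toFun u).2 := fun u => congrArg Prod.snd (hK u)
  have hcos : ∀ t : ℝ, Real.cos (ε * Real.pi * 1 * t) = Real.cos (Real.pi * t) := fun t => by
    rcases hε with rfl | rfl
    · ring_nf
    · rw [← Real.cos_neg]; ring_nf
  have hsin : ∀ t : ℝ, Real.sin (ε * Real.pi * 1 * t) = ε * Real.sin (Real.pi * t) := fun t => by
    rcases hε with rfl | rfl
    · ring_nf
    · rw [neg_one_mul (Real.sin _), ← Real.sin_neg]; ring_nf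
  refine ⟨K.map (twist (ε * Real.pi * 1)) (hs _) ⟨_, hs _, twist_leftInverse _⟩,
    (isUnknot_of_equivalent (K.equivalent_map (fun s => twist (ε * Real.pi * s)) hF ?_
      (fun s _ => ⟨_, hs _, twist_leftInverse _⟩) (hs _) ⟨_, hs _, twist_leftInverse _⟩)).symm,
    fun u => ?_, fun u hu => ?_, fun u hu => ?_, fun u hu => ?_⟩
  · funext q
    simp [twist, rotateX]
  · rw [hN']
    simp only [Knot.map, twist, rotateX, flipMap, hx, hy, hcos, hsin, Prod.mk.injEq, true_and]
    rcases le_or_gt (N.toFun u).1 0 with h0 | h0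
    · simp [Real.smoothTransition.zero_of_nonpos h0]
    rcases le_or_gt 1 (N.toFun u).1 with h1 | h1
    · simp [Real.smoothTransition.one_of_one_le h1]
    rw [hK0 u (subset_closure ⟨h0, h1⟩)]
    ring
  · simp [Knot.map, twist, rotateX, hx, Real.smoothTransition.zero_of_nonpos hu]
  · simp only [Knot.map, twist, rotateX, hx, Real.smoothTransition.one_of_one_le hu, hcos, hsin]
    simp
  · have hst : u ∈ N.stripStrands :=
      subset_closure (show _ ∈ Set.Ioo (0 : ℝ) 1 by rw [hu]; norm_num)
    simp only [Knot.map, twist, rotateX, hx, hy, hu, smoothTransition_half, hcos, hsin, hK0 u hst]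
    rw [show Real.pi * (1 / 2) = Real.pi / 2 by ring]
    simp

end Shadow

/-! ### Transfer of strategies -/

theorem Player.opponent_ne (p : Player) : p.opponent ≠ p := by cases p <;> simp [Player.opponent]

theorem Pseudodiagram.IsComplete.eq_of_subset {S : Shadow} {P Q : Pseudodiagram S}
    (hP : P.IsComplete) (h : P.overStrands ⊆ Q.overStrands) : Q = P := by
  refine Pseudodiagram.ext (Set.Subset.antisymm (fun u hu => ?_) h)
  obtain ⟨w, hw, hwu⟩ := hP.exists_mem (Q.isCrossingStrand u hu)
  rwa [← Q.unique w (h hw) u hu hwu]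

/-- A complete diagram has no extension but itself, so both goals reduce to whether it represents
the unknot. -/
theorem Pseudodiagram.IsComplete.goal_iff {S S' : Shadow} {P : Pseudodiagram S}
    {Q : Pseudodiagram S'} (hP : P.IsComplete) (hQ : Q.IsComplete)
    (h : P.RepresentsUnknot ↔ Q.RepresentsUnknot) (p : Player) : p.Goal P ↔ p.Goal Q := by
  cases p
  · exact ⟨fun hg R hR _ => hQ.eq_of_subset hR ▸ h.1 (hg P subset_rfl hP),
      fun hg R hR _ => hP.eq_of_subset hR ▸ h.2 (hg Q subset_rfl hQ)⟩
  · exact ⟨fun hg R hR _ => hQ.eq_of_subset hR ▸ fun hU => hg P subset_rfl hP (h.2 hU),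
      fun hg R hR _ => hP.eq_of_subset hR ▸ fun hU => hg Q subset_rfl hQ (h.1 hU)⟩

/-- `f` identifies the precrossings of `S` with the precrossings of `S'` other than `c`. -/
structure StrandMap (S S' : Shadow) (c : ℝ × ℝ) where
  f : UnitAddCircle → UnitAddCircle
  crossing : ∀ u, S.IsCrossingStrand u → S'.IsCrossingStrand (f u)
  ne : ∀ u, S.IsCrossingStrand u → S'.toFun (f u) ≠ c
  inj : ∀ u v, S.IsCrossingStrand u → S.IsCrossingStrand v → f u = f v → u = v
  eq_iff : ∀ u v, S.IsCrossingStrand u → S.IsCrossingStrand v →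
    (S.toFun u = S.toFun v ↔ S'.toFun (f u) = S'.toFun (f v))
  surj : ∀ v, S'.IsCrossingStrand v → S'.toFun v ≠ c → ∃ u, S.IsCrossingStrand u ∧ f u = v

namespace StrandMap

variable {S S' : Shadow} {c : ℝ × ℝ}

/-- The pseudodiagram over `S` that corresponds to one over `S'`. -/
def pull (m : StrandMap S S' c) (P : Pseudodiagram S') : Pseudodiagram S where
  overStrands := {u | S.IsCrossingStrand u ∧ m.f u ∈ P.overStrands}
  isCrossingStrand _ hu := hu.1
  unique u hu v hv h := m.inj u v hu.1 hv.1 <| P.unique _ hu.2 _ hv.2 <|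
    (m.eq_iff u v hu.1 hv.1).1 h

variable (m : StrandMap S S' c) {P : Pseudodiagram S'} {u₀ : UnitAddCircle}

theorem pull_isLegal_iff {w : UnitAddCircle} (hw : S.IsCrossingStrand w) :
    (m.pull P).IsLegal w ↔ P.IsLegal (m.f w) := by
  refine ⟨fun h => ⟨m.crossing w hw, fun v hv hvw => ?_⟩,
    fun h => ⟨hw, fun v hv hvw => h.2 _ hv.2 ((m.eq_iff v w hv.1 hw).1 hvw)⟩⟩
  obtain ⟨x, hx, rfl⟩ := m.surj v (P.isCrossingStrand v hv) (hvw ▸ m.ne w hw)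
  exact h.2 x ⟨hx, hv⟩ ((m.eq_iff x w hx hw).2 hvw)

/-- With `c` already resolved, every remaining move on `S'` comes from a move on `S`. -/
theorem exists_of_isLegal (hu₀ : u₀ ∈ P.overStrands) (hc : S'.toFun u₀ = c) {v : UnitAddCircle}
    (hv : P.IsLegal v) : ∃ w, (m.pull P).IsLegal w ∧ m.f w = v := by
  obtain ⟨w, hw, rfl⟩ := m.surj v hv.1 fun h => hv.2 u₀ hu₀ (hc.trans h.symm)
  exact ⟨w, (m.pull_isLegal_iff hw).2 hv, rfl⟩

theorem pull_isComplete_iff (hu₀ : u₀ ∈ P.overStrands) (hc : S'.toFun u₀ = c) :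
    (m.pull P).IsComplete ↔ P.IsComplete := by
  refine ⟨fun h v hv => ?_, fun h w hw => h _ ((m.pull_isLegal_iff hw.1).1 hw)⟩
  obtain ⟨w, hw, -⟩ := m.exists_of_isLegal hu₀ hc hv
  exact h w hw

theorem pull_resolve {w : UnitAddCircle} (hw : (m.pull P).IsLegal w) (h : P.IsLegal (m.f w)) :
    m.pull (P.resolve (m.f w) h) = (m.pull P).resolve w hw := by
  refine Pseudodiagram.ext (Set.ext fun u => ?_)
  simp only [pull, Pseudodiagram.resolve, Set.mem_insert_iff, Set.mem_ofPred_eq]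
  constructor
  · rintro ⟨hu, h | h⟩
    · exact Or.inl (m.inj u w hu hw.1 h)
    · exact Or.inr ⟨hu, h⟩
  · rintro (rfl | ⟨hu, h⟩)
    · exact ⟨hw.1, Or.inl rfl⟩
    · exact ⟨hu, Or.inr h⟩

theorem pull_resolve_ofShadow (hc : S'.toFun u₀ = c)
    (h : (Pseudodiagram.ofShadow S').IsLegal u₀) :
    m.pull ((Pseudodiagram.ofShadow S').resolve u₀ h) = Pseudodiagram.ofShadow S := by
  refine Pseudodiagram.ext (Set.eq_empty_iff_forall_notMem.2 ?_)
  rintro u ⟨hu, rfl | h⟩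
  · exact m.ne u hu hc
  · exact h

open Classical in
/-- The strategy that first makes `u₀` the over-strand and then follows `σ`. -/
noncomputable def strategy (u₀ : UnitAddCircle) (σ : Strategy S) : Strategy S' := fun P =>
  -- Over-strands are never removed, so the empty set singles out the opening position.
  if P.overStrands = ∅ then u₀ else m.f (σ (m.pull P))

theorem strategy_ofShadow (u₀ : UnitAddCircle) (σ : Strategy S) :
    m.strategy u₀ σ (Pseudodiagram.ofShadow S') = u₀ := if_pos rfl

theorem strategy_of_mem (σ : Strategy S) (hu₀ : u₀ ∈ P.overStrands) :
    m.strategy u₀ σ P = m.f (σ (m.pull P)) :=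
  if_neg (Set.nonempty_iff_ne_empty.1 ⟨u₀, hu₀⟩)

/-- The invariant of play: either nothing has been played, or `u₀` is over at `c` and the rest is a
play on `S` in which `p` moves second and follows `σ`. -/
theorem reachable {p : Player} {σ : Strategy S} (hσ : σ.IsWinning p p.opponent)
    (hc : S'.toFun u₀ = c) {q : Player} (h : Reachable p (m.strategy u₀ σ) p q P) :
    (q = p ∧ P = Pseudodiagram.ofShadow S') ∨
      (u₀ ∈ P.overStrands ∧ Reachable p σ p.opponent q (m.pull P)) := by
  induction h with
  | start => exact Or.inl ⟨rfl, rfl⟩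
  | @own P hP h ih =>
    right
    rcases ih with ⟨-, rfl⟩ | ⟨hu, hR⟩
    · generalize hv : m.strategy u₀ σ (Pseudodiagram.ofShadow S') = v at h
      rw [strategy_ofShadow] at hv
      subst hv
      rw [m.pull_resolve_ofShadow hc]
      exact ⟨Or.inl rfl, .start⟩
    · refine ⟨Or.inr hu, ?_⟩
      generalize hv : m.strategy u₀ σ P = v at h
      rw [m.strategy_of_mem σ hu] at hv
      subst hv
      have hl := hσ.1 _ hR fun hcomp => (m.pull_isComplete_iff hu hc).1 hcomp _ h
      rw [m.pull_resolve hl]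
      exact .own hR hl
  | @reply P v hP h ih =>
    right
    rcases ih with ⟨h', -⟩ | ⟨hu, hR⟩
    · exact absurd h' p.opponent_ne
    · obtain ⟨w, hw, rfl⟩ := m.exists_of_isLegal hu hc h
      rw [m.pull_resolve hw]
      exact ⟨Or.inr hu, .reply hR hw⟩

/-- A winning strategy for the second player on `S` gives one for the first player on `S'`. -/
theorem strategy_isWinning {p : Player} {σ : Strategy S} (hσ : σ.IsWinning p p.opponent)
    (hc : S'.toFun u₀ = c) (hu₀ : S'.IsCrossingStrand u₀)
    (hout : ∀ P : Pseudodiagram S', u₀ ∈ P.overStrands → P.IsComplete →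
      ((m.pull P).RepresentsUnknot ↔ P.RepresentsUnknot)) :
    (m.strategy u₀ σ).IsWinning p p := by
  have hl : (Pseudodiagram.ofShadow S').IsLegal u₀ := ⟨hu₀, by simp [Pseudodiagram.ofShadow]⟩
  refine ⟨fun P hP hnc => ?_, fun q P hP hcomp => ?_⟩
  · rcases m.reachable hσ hc hP with ⟨-, rfl⟩ | ⟨hu, hR⟩
    · rwa [strategy_ofShadow]
    · rw [m.strategy_of_mem σ hu]
      have := hσ.1 _ hR fun h => hnc ((m.pull_isComplete_iff hu hc).1 h)
      exact (m.pull_isLegal_iff this.1).1 this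
  · rcases m.reachable hσ hc hP with ⟨-, rfl⟩ | ⟨hu, hR⟩
    · exact absurd hl (hcomp u₀)
    · have hc' := (m.pull_isComplete_iff hu hc).2 hcomp
      exact (hc'.goal_iff hcomp (hout P hu hcomp) p).1 (hσ.2 q _ hR hc')

end StrandMap

/-! ### Flipping a tangle -/

namespace Shadow

variable {N N' S S' : Shadow}

open Classical in
/-- Exchange the two strands at every crossing with `x ≥ 1`. -/
noncomputable def flipStrand (N : Shadow) (n : UnitAddCircle) : UnitAddCircle :=
  if h : N.IsCrossingStrand n ∧ 1 ≤ (N.toFun n).1 then h.1.choose else n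

theorem toFun_flipStrand (N : Shadow) (n : UnitAddCircle) :
    N.toFun (N.flipStrand n) = N.toFun n := by
  unfold flipStrand
  split_ifs with h
  · exact h.1.choose_spec.2
  · rfl

theorem flipStrand_ne {n : UnitAddCircle} (h : N.IsCrossingStrand n) (h1 : 1 ≤ (N.toFun n).1) :
    N.flipStrand n ≠ n := by
  unfold flipStrand
  rw [dif_pos ⟨h, h1⟩]
  exact h.choose_spec.1

theorem flipStrand_of_lt {n : UnitAddCircle} (h1 : (N.toFun n).1 < 1) : N.flipStrand n = n :=
  dif_neg fun h => h1.not_ge h.2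

theorem isCrossingStrand_flipStrand {n : UnitAddCircle} (h : N.IsCrossingStrand n) :
    N.IsCrossingStrand (N.flipStrand n) := by
  rcases lt_or_ge (N.toFun n).1 1 with h1 | h1
  · rwa [flipStrand_of_lt h1]
  · exact ⟨n, (flipStrand_ne h h1).symm, (N.toFun_flipStrand n).symm⟩

/-- Only two strands meet at a crossing, so the arbitrary choice in `flipStrand` is forced. -/
theorem flipStrand_eq {n k : UnitAddCircle} (h1 : 1 ≤ (N.toFun n).1) (hk : k ≠ n)
    (hnk : N.toFun k = N.toFun n) : N.flipStrand n = k := by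
  have h : N.IsCrossingStrand n := ⟨k, hk, hnk⟩
  have hf := N.toFun_flipStrand n
  rcases N.double (N.flipStrand n) n k hf hnk.symm with h | h' | h'
  · exact absurd h (flipStrand_ne ‹_› h1)
  · exact absurd h'.symm hk
  · exact h'

theorem flipStrand_flipStrand {n : UnitAddCircle} (h : N.IsCrossingStrand n) :
    N.flipStrand (N.flipStrand n) = n := by
  rcases lt_or_ge (N.toFun n).1 1 with h1 | h1
  · rw [flipStrand_of_lt h1, flipStrand_of_lt h1]
  · exact flipStrand_eq (by rwa [toFun_flipStrand]) (flipStrand_ne h h1).symm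
      (N.toFun_flipStrand n).symm

/-- Crossings survive the flip. -/
theorem IsTwoTangles.flipMap_ne (h : N.IsTwoTangles) {n : UnitAddCircle}
    (hn : N.IsCrossingStrand n) : flipMap (N.toFun n) ≠ (1 / 2, 0) := by
  obtain ⟨k, hk, hnk⟩ := hn
  intro he
  have hx : (N.toFun n).1 = 1 / 2 := (Prod.ext_iff.1 he).1
  exact h.fst_notMem hk.symm hnk.symm (by rw [hx]; norm_num)

/-- The strand correspondence of a flip. -/
noncomputable def IsTwoTangles.strandMap (h : N.IsTwoTangles)
    (hN' : ∀ u, N'.toFun u = flipMap (N.toFun u)) {φ φ' : ℝ × ℝ → ℝ × ℝ}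
    (hφ : Function.Injective φ) (hφ' : Function.Injective φ')
    {r r' : UnitAddCircle ≃ UnitAddCircle} (hS : ∀ u, S.toFun (r u) = φ (N.toFun u))
    (hS' : ∀ u, S'.toFun (r' u) = φ' (N'.toFun u)) : StrandMap S S' (φ' (1 / 2, 0)) :=
  have hS₁ : ∀ u, S.toFun u = φ (N.toFun (r.symm u)) := fun u => by
    rw [← hS, Equiv.apply_symm_apply]
  have hc : ∀ u, S.IsCrossingStrand u → N.IsCrossingStrand (r.symm u) := by
    rintro u ⟨v, hv, hvu⟩
    rw [hS₁, hS₁] at hvu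
    exact ⟨r.symm v, r.symm.injective.ne hv, hφ hvu⟩
  have hfun : ∀ u, S'.toFun (r' (N.flipStrand (r.symm u))) = φ' (flipMap (N.toFun (r.symm u))) :=
    fun u => by rw [hS', hN', toFun_flipStrand]
  -- Half-turning `T₂` puts its under-strands on top, so there an over-strand of `S` corresponds to
  -- the opposite strand of `S'`.
  { f := fun u => r' (N.flipStrand (r.symm u))
    crossing := fun u hu => by
      obtain ⟨k, hk, hku⟩ := isCrossingStrand_flipStrand (hc u hu)
      exact ⟨r' k, r'.injective.ne hk, by rw [hS', hS', hN', hN', hku]⟩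
    ne := fun u hu he => by
      rw [hfun] at he
      exact h.flipMap_ne (hc u hu) (hφ' he)
    inj := fun u v hu hv he => by
      have := congrArg N.flipStrand (r'.injective he)
      rw [flipStrand_flipStrand (hc u hu), flipStrand_flipStrand (hc v hv)] at this
      exact r.symm.injective this
    eq_iff := fun u v hu hv => by
      rw [hfun, hfun, hS₁, hS₁]
      refine ⟨fun he => by rw [hφ he], fun he => ?_⟩
      rcases eq_of_flipMap_eq (hφ' he) with h1 | h1
      · rw [h1]
      · exact absurd h1 (h.flipMap_ne (hc u hu))
    surj := fun v hv hne => by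
      obtain ⟨n, rfl⟩ := r'.surjective v
      obtain ⟨k, hk, hkn⟩ := hv
      obtain ⟨k, rfl⟩ := r'.surjective k
      rw [hS', hN'] at hne
      rw [hS', hS', hN', hN'] at hkn
      rcases eq_of_flipMap_eq (hφ' hkn) with h1 | h1
      · have hn : N.IsCrossingStrand n := ⟨k, fun e => hk (e ▸ rfl), h1⟩
        refine ⟨r (N.flipStrand n), ?_, ?_⟩
        · obtain ⟨j, hj, hjn⟩ := isCrossingStrand_flipStrand hn
          exact ⟨r j, r.injective.ne hj, by rw [hS, hS, hjn]⟩
        · rw [Equiv.symm_apply_apply, flipStrand_flipStrand hn]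
      · exact absurd ((hφ' hkn).symm.trans h1) fun e => hne (congrArg φ' e) }

/-- The two diagrams before and after flipping a tangle represent equivalent knots. -/
theorem IsTwoTangles.representsUnknot_iff (h : N.IsTwoTangles)
    (hN' : ∀ u, N'.toFun u = flipMap (N.toFun u)) {Φ Φ' : ℝ → ℝ × ℝ → ℝ × ℝ}
    (hΦ : IsPlanarIsotopy Φ) (hΦ' : IsPlanarIsotopy Φ')
    (hi : Function.Injective (Φ 1)) (hi' : Function.Injective (Φ' 1))
    {r r' : UnitAddCircle ≃ UnitAddCircle} (hr : IsReparametrization r.symm)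
    (hr' : IsReparametrization r'.symm) (hS : ∀ u, S.toFun (r u) = Φ 1 (N.toFun u))
    (hS' : ∀ u, S'.toFun (r' u) = Φ' 1 (N'.toFun u)) {P : Pseudodiagram S'} (hP : P.IsComplete)
    {u₀ : UnitAddCircle} (hu₀ : u₀ ∈ P.overStrands) (hc : S'.toFun u₀ = Φ' 1 (1 / 2, 0)) :
    ((h.strandMap hN' hi hi' hS hS').pull P).RepresentsUnknot ↔ P.RepresentsUnknot := by
  set m := h.strandMap hN' hi hi' hS hS' with hm
  have hcomp := (m.pull_isComplete_iff hu₀ hc).2 hP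
  have hf : ∀ n, m.f (r n) = r' (N.flipStrand n) := fun n =>
    congrArg (fun k => r' (N.flipStrand k)) (r.symm_apply_apply n)
  have hmem : ∀ n, r n ∈ (m.pull P).overStrands ↔
      S.IsCrossingStrand (r n) ∧ r' (N.flipStrand n) ∈ P.overStrands := fun n => by
    rw [← hf]; rfl
  have hcr : ∀ n k, k ≠ n → N.toFun k = N.toFun n → S.IsCrossingStrand (r n) :=
    fun n k hk hkn => ⟨r k, r.injective.ne hk, by rw [hS, hS, hkn]⟩
  -- Completeness and uniqueness together say that exactly one of the two strands at each crossing
  -- is over.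
  have hO : ∀ u v, u ≠ v → N.toFun u = N.toFun v →
      (u ∈ {n | r n ∈ (m.pull P).overStrands} ↔ v ∉ {n | r n ∈ (m.pull P).overStrands}) := by
    intro u v huv he
    have heS : S.toFun (r u) = S.toFun (r v) := by rw [hS, hS, he]
    refine ⟨fun hu hv => huv (r.injective ((m.pull P).unique _ hu _ hv heS)), fun hv => ?_⟩
    obtain ⟨w, hw, hwu⟩ := hcomp.exists_mem (hcr u v huv.symm he.symm)
    rcases S.double _ _ _ hwu heS with rfl | h' | rfl
    · exact hw
    · exact absurd (r.injective h') huv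
    · exact absurd hw hv
  obtain ⟨K, hK, hK0, hKO⟩ := h.exists_knot _ hO
  obtain ⟨n₀, rfl⟩ := r'.surjective u₀
  have hn₀ : flipMap (N.toFun n₀) = (1 / 2, 0) := by
    rw [hS', hN'] at hc
    exact hi' hc
  have hx₀ : (N.toFun n₀).1 = 1 / 2 := (Prod.ext_iff.1 hn₀).1
  have hε : (N.toFun n₀).2 = 1 ∨ (N.toFun n₀).2 = -1 := h.snd_eq (by rw [hx₀]; norm_num)
  -- The sense of the turn is the ordinate of the chosen strand at `c`: its height becomes `ε * ε =
  -- 1`, that of the other arc `-1`.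
  obtain ⟨L, hLK, hL, hL0, hL1, hLc⟩ := exists_knot_twist hN' hK hK0 hε
  obtain ⟨K₁, hK₁, hK₁S, hK₁z⟩ := exists_knot_carried hΦ hr hS hK
  obtain ⟨L₁, hL₁, hL₁S, hL₁z⟩ := exists_knot_carried hΦ' hr' hS' hL
  have dK : (m.pull P).IsDiagramOf K₁ := by
    refine ⟨hK₁S, fun u hu v hvu he => ?_⟩
    obtain ⟨n, rfl⟩ := r.surjective u
    obtain ⟨k, rfl⟩ := r.surjective v
    rw [hK₁z, hK₁z]
    rw [hS, hS] at he
    exact hKO n hu k (fun e => hvu (e ▸ rfl)) (hi he)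
  have dL : P.IsDiagramOf L₁ := by
    refine ⟨hL₁S, fun u hu v hvu he => ?_⟩
    obtain ⟨n, rfl⟩ := r'.surjective u
    obtain ⟨k, rfl⟩ := r'.surjective v
    have hkn : k ≠ n := fun e => hvu (e ▸ rfl)
    rw [hL₁z, hL₁z]
    have he' := he
    rw [hS', hS', hN', hN'] at he'
    by_cases hcn : flipMap (N.toFun n) = (1 / 2, 0)
    · have hnn : n = n₀ := r'.injective (P.unique _ hu _ hu₀ (by rw [hc, hS', hN', hcn]))
      subst hnn
      have hxk : (N.toFun k).1 = 1 / 2 := (Prod.ext_iff.1 ((hi' he').trans hcn)).1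
      rw [hLc _ hxk, hLc _ hx₀]
      have hne : (N.toFun k).2 ≠ (N.toFun n).2 := fun e =>
        h.fst_notMem hkn (Prod.ext (hxk.trans hx₀.symm) e) (by rw [hxk]; norm_num)
      have hk : (N.toFun k).2 = 1 ∨ (N.toFun k).2 = -1 := h.snd_eq (by rw [hxk]; norm_num)
      rcases hε with e | e <;> rcases hk with e' | e' <;> rw [e, e'] at hne ⊢ <;>
        first | exact absurd rfl hne | norm_num
    · have heN : N.toFun k = N.toFun n :=
        ((eq_of_flipMap_eq (hi' he').symm).resolve_right hcn).symm
      rcases lt_or_ge (N.toFun n).1 1 with h1 | h1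
      · have h0 : (N.toFun n).1 ≤ 0 := by
          by_contra h0
          exact h.fst_notMem hkn.symm heN.symm ⟨not_le.1 h0, h1⟩
        rw [hL0 k (heN ▸ h0), hL0 n h0]
        refine hKO n ((hmem n).2 ⟨hcr n k hkn heN, ?_⟩) k hkn heN
        rwa [flipStrand_of_lt h1]
      -- In `T₂` heights are negated, so `n` lies over `k` in `L` because `k` lies over `n` in `K`.
      · rw [hL1 k (heN ▸ h1), hL1 n h1, neg_lt_neg_iff]
        refine hKO k ((hmem k).2 ⟨hcr k n hkn.symm heN.symm, ?_⟩) n hkn.symm heN.symm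
        rwa [flipStrand_eq (heN ▸ h1) hkn.symm heN.symm]
  rw [hcomp.representsUnknot_iff dK, hP.representsUnknot_iff dL, hK₁, hL₁, hLK]

/-- The flip has a precrossing at `(1/2, 0)`. -/
theorem IsTwoTangles.exists_crossing (h : N.IsTwoTangles)
    (hN' : ∀ u, N'.toFun u = flipMap (N.toFun u)) :
    ∃ n k, n ≠ k ∧ N'.toFun n = (1 / 2, 0) ∧ N'.toFun k = (1 / 2, 0) := by
  obtain ⟨n, hn⟩ := (h (1 / 2, 1) (by norm_num)).2 (Or.inl rfl)
  obtain ⟨k, hk⟩ := (h (1 / 2, -1) (by norm_num)).2 (Or.inr rfl)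
  refine ⟨n, k, ?_, by rw [hN', hn, flipMap_half], by rw [hN', hk, flipMap_half]⟩
  rintro rfl
  rw [hn] at hk
  have := (Prod.ext_iff.1 hk).2
  norm_num at this

end Shadow

theorem IsPlanarIsotopy.injective_one {Φ : ℝ → ℝ × ℝ → ℝ × ℝ} (h : IsPlanarIsotopy Φ) :
    Function.Injective (Φ 1) := by
  obtain ⟨Ψ, -, hl, -⟩ := h.2.1 1 (by simp)
  exact hl.injective

end KnotGame

/-- If a player has a winning strategy on `S` when playing second, then the same player has a
winning strategy playing first on `S'`, which is `S` with one tangle flipped; moreover, resolving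
the new precrossing `c`, in either of the two ways, is the first move of such a strategy. -/
theorem theorem3 (p : KnotGame.Player) (S S' : KnotGame.Shadow) (c : ℝ × ℝ)
    (hflip : KnotGame.IsFlip S S' c) (hwin : S.WinsPlayingSecond p) :
    S'.WinsPlayingFirst p ∧
      ∀ u : UnitAddCircle, S'.toFun u = c →
        ∃ σ : KnotGame.Strategy S', σ.IsWinning p p ∧
          σ (KnotGame.Pseudodiagram.ofShadow S') = u := by
  obtain ⟨N, N', Φ, Φ', h, hN', hΦ, hcar, hΦ', hcar', rfl⟩ := hflip
  obtain ⟨σ, hσ⟩ := hwin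
  obtain ⟨r, hr, hS⟩ := hcar.exists_equiv
  obtain ⟨r', hr', hS'⟩ := hcar'.exists_equiv
  obtain ⟨n, k, hnk, hn, hk⟩ := h.exists_crossing hN'
  have hSn : S'.toFun (r' n) = Φ' 1 (1 / 2, 0) := by rw [hS', hn]
  have hSk : S'.toFun (r' k) = Φ' 1 (1 / 2, 0) := by rw [hS', hk]
  have key : ∀ u : UnitAddCircle, S'.toFun u = Φ' 1 (1 / 2, 0) →
      ∃ σ : KnotGame.Strategy S', σ.IsWinning p p ∧
        σ (KnotGame.Pseudodiagram.ofShadow S') = u := by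
    intro u hu
    have hcr : S'.IsCrossingStrand u := by
      by_cases hun : u = r' n
      · exact ⟨r' k, fun e => hnk (r'.injective (hun.symm.trans e.symm)), hSk.trans hu.symm⟩
      · exact ⟨r' n, fun e => hun e.symm, hSn.trans hu.symm⟩
    have hi := hΦ.injective_one
    have hi' := hΦ'.injective_one
    exact ⟨(h.strandMap hN' hi hi' hS hS').strategy u σ,
      (h.strandMap hN' hi hi' hS hS').strategy_isWinning hσ hu hcr fun P huP hP =>
        h.representsUnknot_iff hN' hΦ hΦ' hi hi' hr hr' hS hS' hP huP hu,
      (h.strandMap hN' hi hi' hS hS').strategy_ofShadow u σ⟩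
  obtain ⟨τ, hτ, -⟩ := key _ hSn
  exact ⟨⟨τ, hτ⟩, key⟩
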